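/- Let $n\ge 0$ and let $S_n$ be the symmetric group on $\{1,\dots,n\}$, with simple transpositions $s_i=(i,i+1)$ for $1\le i\le n-1$, composition $(\sigma\rho)(j)=\sigma(\rho(j))$, and length function $\ell$ (the least number of factors in an expression as a product of simple transpositions). Put $\mathrm{Des}_L(\sigma)=\{i : \ell(s_i\sigma)<\ell(\sigma)\}$ and $\mathrm{Des}_R(\sigma)=\{i : \ell(\sigma s_i)<\ell(\sigma)\}$. The left weak Bruhat order $\preceq_L$ (resp. the right weak Bruhat order $\preceq_R$) on $S_n$ is the partial order whose covering relations are $\sigma\prec s_i\sigma$ for $i\notin\mathrm{Des}_L(\sigma)$ (resp. $\sigma\prec\sigma s_i$ for $i\notin\mathrm{Des}_R(\sigma)$); write $[\sigma,\rho]_L$ and $[\sigma,\rho]_R$ for the corresponding closed intervals. Let $\mathrm{Int}(n)=\{[\sigma,\rho]_L : \sigma\preceq_L\rho\}$. For $I_1,I_2\in\mathrm{Int}(n)$ write $I_1\overset{D}{\simeq} I_2$ if there is a poset isomorphism $f:(I_1,\preceq_L)\to(I_2,\preceq_L)$ with $\mathrm{Des}_L(f(\gamma))=\mathrm{Des}_L(\gamma)$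 for all $\gamma\in I_1$; this is an equivalence relation on $\mathrm{Int}(n)$. Theorem 4.5. Let $C$ be an equivalence class of $\overset{D}{\simeq}$ on $\mathrm{Int}(n)$. Then $\rho\sigma^{-1}$ is the same permutation $\xi_C$ for all $\sigma\preceq_L\rho$ with $[\sigma,\rho]_L\in C$. The set of minima $\{\sigma : \sigma\preceq_L\rho \text{ and } [\sigma,\rho]_L\in C\text{ for some }\rho\}$ and the set of maxima $\{\rho : \sigma\preceq_L\rho\text{ and }[\sigma,\rho]_L\in C\text{ for some }\sigma\}$ are nonempty right weak Bruhat intervals: there are $\sigma_0\preceq_R\sigma_1$ and $\rho_0\preceq_R\rho_1$ in $S_n$ such that they equal $[\sigma_0,\sigma_1]_R$ and $[\rho_0,\rho_1]_R$, respectively. Consequently $$C=\{[\gamma,\xi_C\gamma]_L : \gamma\in[\sigma_0,\sigma_1]_R\}.$$ -/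

import Mathlib

namespace WeakBruhat

/-- The simple transposition `s_i = (i, i+1)` in the symmetric group on `Fin n`
(indices and letters are counted from `0`). -/
def simpleTransp {n : ℕ} (i : Fin (n - 1)) : Equiv.Perm (Fin n) :=
  Equiv.swap ⟨i.val, by omega⟩ ⟨i.val + 1, by omega⟩

/-- The length of `σ`: the least number of factors in an expression of `σ` as a product of
simple transpositions (every permutation has such an expression). -/
noncomputable def length {n : ℕ} (σ : Equiv.Perm (Fin n)) : ℕ :=
  sInf {k : ℕ | ∃ w : List (Fin (n - 1)), w.length = k ∧ (w.map simpleTransp).prod = σ}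

/-- The left descent set `{i | ℓ(s_i σ) < ℓ(σ)}`. -/
def leftDescents {n : ℕ} (σ : Equiv.Perm (Fin n)) : Set (Fin (n - 1)) :=
  {i | length (simpleTransp i * σ) < length σ}

/-- The right descent set `{i | ℓ(σ s_i) < ℓ(σ)}`. -/
def rightDescents {n : ℕ} (σ : Equiv.Perm (Fin n)) : Set (Fin (n - 1)) :=
  {i | length (σ * simpleTransp i) < length σ}

/-- Covering relation of the left weak Bruhat order: `σ ⋖ s_i σ` whenever `i ∉ Des_L σ`. -/
def LeftCovers {n : ℕ} (σ ρ : Equiv.Perm (Fin n)) : Prop :=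
  ∃ i : Fin (n - 1), i ∉ leftDescents σ ∧ ρ = simpleTransp i * σ

/-- Covering relation of the right weak Bruhat order: `σ ⋖ σ s_i` whenever `i ∉ Des_R σ`. -/
def RightCovers {n : ℕ} (σ ρ : Equiv.Perm (Fin n)) : Prop :=
  ∃ i : Fin (n - 1), i ∉ rightDescents σ ∧ ρ = σ * simpleTransp i

/-- The left weak Bruhat order. -/
def LeftLE {n : ℕ} (σ ρ : Equiv.Perm (Fin n)) : Prop :=
  Relation.ReflTransGen LeftCovers σ ρ

/-- The right weak Bruhat order. -/
def RightLE {n : ℕ} (σ ρ : Equiv.Perm (Fin n)) : Prop :=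
  Relation.ReflTransGen RightCovers σ ρ

/-- The closed interval `[σ, ρ]_L` of the left weak Bruhat order. -/
def leftInterval {n : ℕ} (σ ρ : Equiv.Perm (Fin n)) : Set (Equiv.Perm (Fin n)) :=
  {γ | LeftLE σ γ ∧ LeftLE γ ρ}

/-- The closed interval `[σ, ρ]_R` of the right weak Bruhat order. -/
def rightInterval {n : ℕ} (σ ρ : Equiv.Perm (Fin n)) : Set (Equiv.Perm (Fin n)) :=
  {γ | RightLE σ γ ∧ RightLE γ ρ}

/-- The set `Int(n)` of nonempty left weak Bruhat intervals. -/
def leftIntervals (n : ℕ) : Set (Set (Equiv.Perm (Fin n))) :=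
  {I | ∃ σ ρ, LeftLE σ ρ ∧ I = leftInterval σ ρ}

/-- There is a descent-preserving poset isomorphism `(I₁, ≼_L) → (I₂, ≼_L)`. -/
def DescEquiv {n : ℕ} (I₁ I₂ : Set (Equiv.Perm (Fin n))) : Prop :=
  ∃ f : I₁ ≃ I₂,
    (∀ γ γ' : I₁, LeftLE (γ : Equiv.Perm (Fin n)) γ' ↔ LeftLE (f γ : Equiv.Perm (Fin n)) (f γ')) ∧
    ∀ γ : I₁, leftDescents (γ : Equiv.Perm (Fin n)) = leftDescents (f γ : Equiv.Perm (Fin n))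

theorem descEquiv_equivalence (n : ℕ) :
    Equivalence (DescEquiv : Set (Equiv.Perm (Fin n)) → Set (Equiv.Perm (Fin n)) → Prop) where
  refl I := ⟨Equiv.refl I, fun _ _ => Iff.rfl, fun _ => rfl⟩
  symm := by
    rintro I₁ I₂ ⟨f, hf, hd⟩
    refine ⟨f.symm, fun γ γ' => ?_, fun γ => ?_⟩
    · simpa using (hf (f.symm γ) (f.symm γ')).symm
    · simpa using (hd (f.symm γ)).symm
  trans := by
    rintro I₁ I₂ I₃ ⟨f, hf, hd⟩ ⟨g, hg, he⟩
    exact ⟨f.trans g, fun γ γ' => (hf γ γ').trans (hg (f γ) (f γ')),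
      fun γ => (hd γ).trans (he (f γ))⟩

/-- `C` is an equivalence class of `DescEquiv` on the set `Int(n)`. -/
def IsDescClass {n : ℕ} (C : Set (Set (Equiv.Perm (Fin n)))) : Prop :=
  ∃ I ∈ leftIntervals n, C = {J | J ∈ leftIntervals n ∧ DescEquiv I J}

/-- The set `{σ | [σ, ρ]_L ∈ C}` of minima of the intervals in `C`. -/
def minima {n : ℕ} (C : Set (Set (Equiv.Perm (Fin n)))) : Set (Equiv.Perm (Fin n)) :=
  {σ | ∃ ρ, LeftLE σ ρ ∧ leftInterval σ ρ ∈ C}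

/-- The set `{ρ | [σ, ρ]_L ∈ C}` of maxima of the intervals in `C`. -/
def maxima {n : ℕ} (C : Set (Set (Equiv.Perm (Fin n)))) : Set (Equiv.Perm (Fin n)) :=
  {ρ | ∃ σ, LeftLE σ ρ ∧ leftInterval σ ρ ∈ C}

end WeakBruhat

namespace WeakBruhat

open Relation

variable {n : ℕ}

/-! Write an interval as `[σ, ξσ]_L`; its elements are the `uσ` with `u ≼_L ξ`
(`mul_mem_leftInterval_iff`). A descent-preserving isomorphism preserves the label of each cover, so
it is the right translation `uσ ↦ uσ'` (`descEquiv_eq_mul`). Hence `ξ` is an invariant of the class,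
and the minima are the `τ` with `τ ≼_L ξτ` and `Des_L(uτ) = Des_L(uσ)` for all `u ≼_L ξ`.

These conditions only prescribe that some pairs are inversions of `τ` and others are not
(`leftLE_and_leftDescents_eq_iff`). Both families of pairs can be chosen cotransitive: if `(a, c)`
is in the family and `a < b < c`, so is `(a, b)` or `(b, c)`. Since the right weak order is
inclusion of inversion sets and inversion sets are the biclosed sets, such constraints cut out an
interval when satisfiable (`exists_rightInterval_eq`). Left multiplication by `ξ` carries the
interval of minima to that of maxima (`rightLE_mul_mul_iff`). -/

/-! ### Inversions and adjacent exchanges -/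

/-- `a < b` are letters of `σ` such that `b` stands to the left of `a` in the word of `σ`. -/
def Inversion (σ : Equiv.Perm (Fin n)) (a b : Fin n) : Prop :=
  a < b ∧ σ⁻¹ b < σ⁻¹ a

/-- The number of inversions of `σ`. -/
noncomputable def inversionCount (σ : Equiv.Perm (Fin n)) : ℕ :=
  {p : Fin n × Fin n | Inversion σ p.1 p.2}.ncard

theorem inversion_mul_swap {σ : Equiv.Perm (Fin n)} {p q : Fin n} (hpq : q.val = p.val + 1)
    (h : σ p < σ q) (a b : Fin n) :
    Inversion (σ * Equiv.swap p q) a b ↔ Inversion σ a b ∨ (a = σ p ∧ b = σ q) := by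
  obtain ⟨x, rfl⟩ := σ.surjective a
  obtain ⟨y, rfl⟩ := σ.surjective b
  simp only [Inversion, mul_inv_rev, Equiv.swap_inv, Equiv.Perm.mul_apply,
    Equiv.Perm.coe_inv, Equiv.symm_apply_apply, EmbeddingLike.apply_eq_iff_eq, Equiv.swap_apply_def]
  by_cases hxp : x = p
  · subst hxp
    by_cases hyq : y = q
    · subst hyq
      have : y ≠ x := by rintro rfl; omega
      simp [h, this]
      omega
    · by_cases hyx : y = x
      · subst hyx; simp [hyq]
      · simp only [hyq, hyx, if_true, if_false]
        have : y.val ≠ q.val := fun e => hyq (Fin.ext e)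
        have : y.val ≠ x.val := fun e => hyx (Fin.ext e)
        simp only [Fin.lt_def, and_false, or_false]
        refine and_congr_right fun _ => ?_
        omega
  · by_cases hxq : x = q
    · subst hxq
      by_cases hyp : y = p
      · subst hyp
        simp [hxp, h.le]
      · by_cases hyx : y = x
        · subst hyx; simp [hxp]
        · simp only [hxp, hyp, hyx, if_true, if_false]
          have : y.val ≠ p.val := fun e => hyp (Fin.ext e)
          have : y.val ≠ x.val := fun e => hyx (Fin.ext e)
          simp only [Fin.lt_def, false_and, or_false]
          refine and_congr_right fun _ => ?_
          omega
    · have : x.val ≠ p.val := fun e => hxp (Fin.ext e)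
      have : x.val ≠ q.val := fun e => hxq (Fin.ext e)
      simp only [hxp, hxq, if_false, false_and, or_false]
      refine and_congr_right fun _ => ?_
      split_ifs <;> subst_vars <;> simp only [Fin.lt_def] <;> omega

theorem inversionCount_mul_swap {σ : Equiv.Perm (Fin n)} {p q : Fin n}
    (hpq : q.val = p.val + 1) (h : σ p < σ q) :
    inversionCount (σ * Equiv.swap p q) = inversionCount σ + 1 := by
  have hne : p < q := by rw [Fin.lt_def]; omega
  have hs : {r : Fin n × Fin n | Inversion (σ * Equiv.swap p q) r.1 r.2} =
      insert (σ p, σ q) {r : Fin n × Fin n | Inversion σ r.1 r.2} := by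
    ext ⟨a, b⟩
    simp [inversion_mul_swap hpq h, or_comm]
  unfold inversionCount
  rw [hs, Set.ncard_insert_of_notMem _ (Set.toFinite _)]
  simp [Inversion, hne.le]

theorem inversionCount_mul_swap_of_gt {σ : Equiv.Perm (Fin n)} {p q : Fin n}
    (hpq : q.val = p.val + 1) (h : σ q < σ p) :
    inversionCount σ = inversionCount (σ * Equiv.swap p q) + 1 := by
  have := inversionCount_mul_swap (σ := σ * Equiv.swap p q) hpq (by simpa using h)
  rwa [mul_assoc, Equiv.swap_mul_self, mul_one] at this

theorem not_inversion_one (a b : Fin n) : ¬ Inversion 1 a b := fun h => by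
  have h2 : b < a := by simpa using h.2
  exact absurd h.1 h2.not_gt

theorem inversionCount_one : inversionCount (1 : Equiv.Perm (Fin n)) = 0 := by
  simp [inversionCount, not_inversion_one]

theorem inv_lt_inv_iff_of_inversion_iff {σ τ : Equiv.Perm (Fin n)}
    (h : ∀ a b, Inversion σ a b ↔ Inversion τ a b) (a b : Fin n) :
    σ⁻¹ a < σ⁻¹ b ↔ τ⁻¹ a < τ⁻¹ b := by
  rcases lt_trichotomy a b with hab | rfl | hab
  · have := h a b
    simp only [Inversion, hab, true_and] at this
    have h1 : σ⁻¹ a ≠ σ⁻¹ b := fun e => hab.ne (σ⁻¹.injective e)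
    have h2 : τ⁻¹ a ≠ τ⁻¹ b := fun e => hab.ne (τ⁻¹.injective e)
    rw [lt_iff_le_and_ne, lt_iff_le_and_ne, ← not_lt, ← not_lt, this]
    simp only [ne_eq, h1, h2, not_false_eq_true, and_true]
  · simp
  · simpa only [Inversion, hab, true_and] using h b a

theorem eq_of_inversion_iff {σ τ : Equiv.Perm (Fin n)}
    (h : ∀ a b, Inversion σ a b ↔ Inversion τ a b) : σ = τ := by
  have hm : ∀ x y, (σ⁻¹ * τ) x < (σ⁻¹ * τ) y ↔ x < y := fun x y => by
    simpa using inv_lt_inv_iff_of_inversion_iff h (τ x) (τ y)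
  let e : Fin n ≃o Fin n := ⟨σ⁻¹ * τ, fun {x y} => by
    rw [← not_lt, ← not_lt]; exact not_congr (hm y x)⟩
  have he : e = OrderIso.refl _ := Subsingleton.elim _ _
  ext x
  have hx : (σ⁻¹ * τ) x = x := congrArg (fun g : Fin n ≃o Fin n => g x) he
  rw [Equiv.Perm.mul_apply, Equiv.Perm.inv_eq_iff_eq] at hx
  rw [hx]

/-! ### Biclosed sets and the right weak order -/

/-- Adjacent letters of the word of `σ` that are in increasing order get exchanged. -/
def RightStep (σ ρ : Equiv.Perm (Fin n)) : Prop :=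
  ∃ p q : Fin n, q.val = p.val + 1 ∧ σ p < σ q ∧ ρ = σ * Equiv.swap p q

/-- A set of pairs `a < b` such that both it and its complement are transitive. -/
structure Biclosed (T : Fin n → Fin n → Prop) : Prop where
  lt : ∀ {a b}, T a b → a < b
  trans : ∀ {a b c}, T a b → T b c → T a c
  cotrans : ∀ {a b c}, a < b → b < c → T a c → T a b ∨ T b c

theorem biclosed_inversion (σ : Equiv.Perm (Fin n)) : Biclosed (Inversion σ) where
  lt h := h.1
  trans h h' := ⟨h.1.trans h'.1, h'.2.trans h.2⟩
  cotrans {a b c} hab hbc h := by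
    rcases lt_or_ge (σ⁻¹ b) (σ⁻¹ a) with h' | h'
    · exact Or.inl ⟨hab, h'⟩
    · exact Or.inr ⟨hbc, h.2.trans_le h'⟩

theorem Biclosed.compl {T : Fin n → Fin n → Prop} (hT : Biclosed T) :
    Biclosed fun a b => a < b ∧ ¬ T a b where
  lt h := h.1
  trans h h' := ⟨h.1.trans h'.1, fun h'' => (hT.cotrans h.1 h'.1 h'').elim h.2 h'.2⟩
  cotrans hab hbc h := by
    by_contra hc
    simp only [hab, hbc, true_and, not_or, not_not] at hc
    exact h.2 (hT.trans hc.1 hc.2)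

/-- For cotransitivity, follow a chain from `a` to `c`: it either visits `b`, or one link jumps over
`b`. That link lies in a single `T i`, whose cotransitivity splits it at `b`. -/
theorem biclosed_transGen_iUnion {ι : Type*} {T : ι → Fin n → Fin n → Prop}
    (hT : ∀ i, Biclosed (T i)) : Biclosed (TransGen fun a b => ∃ i, T i a b) where
  lt h := by
    induction h with
    | single h => exact (hT _).lt h.choose_spec
    | tail _ h ih => exact ih.trans ((hT _).lt h.choose_spec)
  trans h h' := h.trans h'
  cotrans {a b c} hab hbc h := by
    have step : ∀ {x y}, x < b → b < y → (∃ i, T i x y) →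
        (∃ i, T i x b) ∨ ∃ i, T i b y := fun hx hy ⟨i, hi⟩ =>
      ((hT i).cotrans hx hy hi).imp (fun h => ⟨i, h⟩) fun h => ⟨i, h⟩
    induction h with
    | single h => exact (step hab hbc h).imp .single .single
    | @tail y z hy hyz ih =>
      rcases lt_trichotomy b y with h | rfl | h
      · exact (ih h).imp_right fun h => h.tail hyz
      · exact Or.inl hy
      · exact (step h hbc hyz).imp (fun h => hy.tail h) .single

/-- A transitive closure of relations avoiding a cotransitive relation avoids it as well. -/
theorem not_of_transGen {R B : Fin n → Fin n → Prop} (hlt : ∀ {a b}, R a b → a < b)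
    (hB : ∀ {a b c}, a < b → b < c → B a c → B a b ∨ B b c)
    (hRB : ∀ {a b}, R a b → ¬ B a b) {a b : Fin n} (h : TransGen R a b) : a < b ∧ ¬ B a b := by
  induction h with
  | single h => exact ⟨hlt h, hRB h⟩
  | tail _ h ih =>
    exact ⟨ih.1.trans (hlt h), fun hb => (hB ih.1 (hlt h) hb).elim ih.2 (hRB h)⟩

theorem exists_adjacent_of_biclosed {T : Fin n → Fin n → Prop} (hT : Biclosed T)
    {σ : Equiv.Perm (Fin n)} (hσ : ∀ a b, Inversion σ a b → T a b) :
    ∀ (d : ℕ) (p q : Fin n), q.val = p.val + 1 + d → T (σ p) (σ q) →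
      ∃ p q : Fin n, q.val = p.val + 1 ∧ T (σ p) (σ q) := by
  intro d
  induction d with
  | zero => exact fun p q h hT => ⟨p, q, h, hT⟩
  | succ d ih =>
    intro p q hq h
    have hpq := hT.lt h
    obtain ⟨r, hr⟩ : ∃ r : Fin n, r.val = p.val + 1 := ⟨⟨p.val + 1, by omega⟩, rfl⟩
    -- Compare the letter next to `σ p` with `σ p` and `σ q`. If it lies between them,
    -- cotransitivity applies; otherwise it forms an inversion of `σ` with one of them, and
    -- transitivity applies.
    have hpr : p < r := by rw [Fin.lt_def]; omega
    have hrq : r < q := by rw [Fin.lt_def]; omega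
    rcases lt_or_gt_of_ne (fun e => hpr.ne (σ.injective e) : σ p ≠ σ r) with h1 | h1
    · rcases lt_or_gt_of_ne (fun e => hrq.ne (σ.injective e) : σ r ≠ σ q) with h2 | h2
      · rcases hT.cotrans h1 h2 h with h3 | h3
        · exact ⟨p, r, hr, h3⟩
        · exact ih r q (by omega) h3
      · exact ⟨p, r, hr, hT.trans h (hσ _ _ ⟨h2, by simpa using hrq⟩)⟩
    · exact ih r q (by omega) (hT.trans (hσ _ _ ⟨h1, by simpa using hpr⟩) h)

/-- As long as a pair of `T` is missing from the inversions of `σ`, some adjacent ascent lies in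
`T`; exchanging it adds exactly that pair. Starting from the identity, every biclosed set is
realised as an inversion set. -/
theorem exists_reflTransGen_rightStep {T : Fin n → Fin n → Prop} (hT : Biclosed T)
    (σ : Equiv.Perm (Fin n)) (hσ : ∀ a b, Inversion σ a b → T a b) :
    ∃ ρ, ReflTransGen RightStep σ ρ ∧ ∀ a b, Inversion ρ a b ↔ T a b := by
  induction hk : {p : Fin n × Fin n | T p.1 p.2}.ncard - inversionCount σ using
    Nat.strong_induction_on generalizing σ with
  | _ k ih =>
  by_cases hall : ∀ a b, T a b → Inversion σ a b
  · exact ⟨σ, .refl, fun a b => ⟨hσ a b, hall a b⟩⟩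
  push Not at hall
  obtain ⟨a, b, hab, hi⟩ := hall
  have hlt := hT.lt hab
  have hpos : σ⁻¹ a < σ⁻¹ b := by
    refine lt_of_le_of_ne (not_lt.1 fun h => hi ⟨hlt, h⟩) fun e => hlt.ne (σ⁻¹.injective e)
  obtain ⟨p, q, hpq, hTpq⟩ := exists_adjacent_of_biclosed hT hσ
    ((σ⁻¹ b).val - (σ⁻¹ a).val - 1) (σ⁻¹ a) (σ⁻¹ b)
    (by rw [Fin.lt_def] at hpos; omega) (by simpa using hab)
  have hs := inversionCount_mul_swap hpq (hT.lt hTpq)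
  have hσ' : ∀ a b, Inversion (σ * Equiv.swap p q) a b → T a b := fun a b h => by
    rcases (inversion_mul_swap hpq (hT.lt hTpq) a b).1 h with h | ⟨rfl, rfl⟩
    · exact hσ a b h
    · exact hTpq
  have hle : inversionCount (σ * Equiv.swap p q) ≤ {p : Fin n × Fin n | T p.1 p.2}.ncard :=
    Set.ncard_le_ncard (fun r h => hσ' r.1 r.2 h) (Set.toFinite _)
  obtain ⟨ρ, h1, h2⟩ := ih _ (by omega) _ hσ' rfl
  exact ⟨ρ, .head ⟨p, q, hpq, hT.lt hTpq, rfl⟩ h1, h2⟩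

theorem reflTransGen_rightStep_iff {σ τ : Equiv.Perm (Fin n)} :
    ReflTransGen RightStep σ τ ↔ ∀ a b, Inversion σ a b → Inversion τ a b := by
  constructor
  · intro h
    induction h with
    | refl => exact fun _ _ h => h
    | tail _ h ih =>
      obtain ⟨p, q, hpq, hlt, rfl⟩ := h
      exact fun a b h => (inversion_mul_swap hpq hlt a b).2 (Or.inl (ih a b h))
  · intro h
    obtain ⟨ρ, h1, h2⟩ := exists_reflTransGen_rightStep (biclosed_inversion τ) σ h
    rwa [← eq_of_inversion_iff h2]

/-! ### Length, descents and weak orders in terms of inversions -/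

theorem exists_simpleTransp_eq {p q : Fin n} (h : q.val = p.val + 1) :
    ∃ i : Fin (n - 1), i.val = p.val ∧ simpleTransp i = Equiv.swap p q := by
  refine ⟨⟨p.val, by omega⟩, rfl, ?_⟩
  unfold simpleTransp
  congr 1
  exact Fin.ext h.symm

theorem exists_word (σ : Equiv.Perm (Fin n)) :
    ∃ w : List (Fin (n - 1)), w.length = inversionCount σ ∧ (w.map simpleTransp).prod = σ := by
  have h : ReflTransGen RightStep 1 σ :=
    reflTransGen_rightStep_iff.2 fun a b h => (not_inversion_one a b h).elim
  induction h with
  | refl => exact ⟨[], by simp [inversionCount_one]⟩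
  | tail _ h ih =>
    obtain ⟨p, q, hpq, hlt, rfl⟩ := h
    obtain ⟨w, hw, hp⟩ := ih
    obtain ⟨i, -, hi⟩ := exists_simpleTransp_eq hpq
    exact ⟨w ++ [i], by simp [hw, inversionCount_mul_swap hpq hlt], by simp [hp, hi]⟩

theorem inversionCount_mul_simpleTransp_le (σ : Equiv.Perm (Fin n)) (i : Fin (n - 1)) :
    inversionCount (σ * simpleTransp i) ≤ inversionCount σ + 1 := by
  unfold simpleTransp
  rcases lt_or_gt_of_ne (fun e => by simpa using σ.injective e :
    σ ⟨i.val, by omega⟩ ≠ σ ⟨i.val + 1, by omega⟩) with h | h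
  · exact (inversionCount_mul_swap rfl h).le
  · have := inversionCount_mul_swap_of_gt rfl h
    omega

theorem length_eq_inversionCount (σ : Equiv.Perm (Fin n)) : length σ = inversionCount σ := by
  apply le_antisymm
  · exact Nat.sInf_le (exists_word σ)
  · refine le_csInf ⟨_, exists_word σ⟩ ?_
    rintro k ⟨w, rfl, rfl⟩
    induction w using List.reverseRecOn with
    | nil => simp [inversionCount_one]
    | append_singleton w i ih =>
      simpa using (inversionCount_mul_simpleTransp_le _ i).trans (Nat.succ_le_succ ih)

theorem mem_rightDescents {σ : Equiv.Perm (Fin n)} {i : Fin (n - 1)} :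
    i ∈ rightDescents σ ↔ σ ⟨i.val + 1, by omega⟩ < σ ⟨i.val, by omega⟩ := by
  simp only [rightDescents, Set.mem_ofPred_eq, length_eq_inversionCount, simpleTransp]
  rcases lt_or_gt_of_ne (fun e => by simpa using σ.injective e :
    σ ⟨i.val, by omega⟩ ≠ σ ⟨i.val + 1, by omega⟩) with h | h
  · simp [inversionCount_mul_swap rfl h, h.le]
  · have := inversionCount_mul_swap_of_gt rfl h
    simp only [h, iff_true]
    omega

theorem rightCovers_iff {σ ρ : Equiv.Perm (Fin n)} : RightCovers σ ρ ↔ RightStep σ ρ := by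
  constructor
  · rintro ⟨i, hi, rfl⟩
    rw [mem_rightDescents, not_lt] at hi
    exact ⟨_, _, rfl, lt_of_le_of_ne hi fun e => by simpa using σ.injective e, rfl⟩
  · rintro ⟨p, q, hpq, hlt, rfl⟩
    obtain ⟨i, hip, hi⟩ := exists_simpleTransp_eq hpq
    refine ⟨i, ?_, by rw [hi]⟩
    rw [mem_rightDescents, not_lt]
    convert hlt.le
    omega

theorem rightLE_iff {σ τ : Equiv.Perm (Fin n)} :
    RightLE σ τ ↔ ∀ a b, Inversion σ a b → Inversion τ a b := by
  rw [← reflTransGen_rightStep_iff, RightLE]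
  have : (RightCovers : Equiv.Perm (Fin n) → _) = RightStep := by
    ext; exact rightCovers_iff
  rw [this]

theorem simpleTransp_inv (i : Fin (n - 1)) : (simpleTransp i)⁻¹ = simpleTransp i :=
  Equiv.swap_inv _ _

theorem length_inv (σ : Equiv.Perm (Fin n)) : length σ⁻¹ = length σ := by
  have key : ∀ τ : Equiv.Perm (Fin n), length τ⁻¹ ≤ length τ := fun τ => by
    obtain ⟨w, hw, hp⟩ := exists_word τ
    rw [length_eq_inversionCount τ]
    refine Nat.sInf_le ⟨w.reverse, by simpa using hw, ?_⟩
    rw [← hp, List.prod_inv_reverse]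
    simp [Function.comp_def, simpleTransp_inv]
  exact (key σ).antisymm (by simpa using key σ⁻¹)

theorem leftDescents_eq (σ : Equiv.Perm (Fin n)) : leftDescents σ = rightDescents σ⁻¹ := by
  ext i
  rw [leftDescents, rightDescents, Set.mem_ofPred_eq, Set.mem_ofPred_eq, ← length_inv, length_inv σ,
    mul_inv_rev, simpleTransp_inv]

theorem mem_leftDescents {σ : Equiv.Perm (Fin n)} {i : Fin (n - 1)} :
    i ∈ leftDescents σ ↔ σ⁻¹ ⟨i.val + 1, by omega⟩ < σ⁻¹ ⟨i.val, by omega⟩ := by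
  rw [leftDescents_eq, mem_rightDescents]

theorem leftCovers_iff {σ ρ : Equiv.Perm (Fin n)} : LeftCovers σ ρ ↔ RightCovers σ⁻¹ ρ⁻¹ := by
  simp only [LeftCovers, RightCovers, leftDescents_eq]
  refine exists_congr fun i => and_congr_right fun _ => ?_
  rw [← inv_inj, mul_inv_rev, simpleTransp_inv]

theorem leftLE_iff_rightLE {σ ρ : Equiv.Perm (Fin n)} : LeftLE σ ρ ↔ RightLE σ⁻¹ ρ⁻¹ := by
  constructor
  · exact fun h => ReflTransGen.lift (p := RightCovers) (·⁻¹) (fun _ _ h => leftCovers_iff.1 h) _ _ h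
  · intro h
    have := ReflTransGen.lift (p := LeftCovers) (·⁻¹)
      (fun a b h => leftCovers_iff.2 (by simpa using h)) _ _ h
    simpa [LeftLE, Function.onFun] using this

theorem leftLE_iff {σ ρ : Equiv.Perm (Fin n)} :
    LeftLE σ ρ ↔ ∀ i j, i < j → σ j < σ i → ρ j < ρ i := by
  rw [leftLE_iff_rightLE, rightLE_iff]
  simp only [Inversion, inv_inv]
  exact forall₂_congr fun i j => ⟨fun h hij h' => (h ⟨hij, h'⟩).2, fun h h' => ⟨h'.1, h h'.1 h'.2⟩⟩

theorem RightLE.eq_or_lt {σ ρ : Equiv.Perm (Fin n)} (h : RightLE σ ρ) :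
    σ = ρ ∨ inversionCount σ < inversionCount ρ := by
  induction h with
  | refl => exact Or.inl rfl
  | @tail b c _ h ih =>
    obtain ⟨p, q, hpq, hlt, rfl⟩ := rightCovers_iff.1 h
    have := inversionCount_mul_swap hpq hlt
    right
    rcases ih with rfl | h <;> omega

theorem LeftLE.eq_or_lt {σ ρ : Equiv.Perm (Fin n)} (h : LeftLE σ ρ) :
    σ = ρ ∨ inversionCount σ⁻¹ < inversionCount ρ⁻¹ :=
  (leftLE_iff_rightLE.1 h).eq_or_lt.imp_left inv_injective.eq_iff.1

theorem LeftLE.antisymm {σ ρ : Equiv.Perm (Fin n)} (h : LeftLE σ ρ) (h' : LeftLE ρ σ) :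
    σ = ρ := by
  rcases h.eq_or_lt with h | h
  · exact h
  · rcases h'.eq_or_lt with h' | h'
    · exact h'.symm
    · omega

theorem LeftCovers.inversionCount_eq {σ ρ : Equiv.Perm (Fin n)} (h : LeftCovers σ ρ) :
    inversionCount ρ⁻¹ = inversionCount σ⁻¹ + 1 := by
  obtain ⟨p, q, hpq, hlt, h⟩ := rightCovers_iff.1 (leftCovers_iff.1 h)
  rw [h, inversionCount_mul_swap hpq hlt]

/-! ### Left intervals as translates of lower intervals -/

theorem leftLE_mul_iff {σ u : Equiv.Perm (Fin n)} :
    LeftLE σ (u * σ) ↔ ∀ a b, Inversion σ a b → u a < u b := by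
  rw [leftLE_iff]
  constructor
  · intro h a b hab
    simpa using h _ _ hab.2 (by simpa using hab.1)
  · intro h i j hij hlt
    exact h _ _ ⟨hlt, by simpa using hij⟩

/-- Pairs of positions inverted by `σ` stay inverted in both products, so only the pairs in order in
`σ` matter, and there the comparison is between `u` and `v`. -/
theorem leftLE_mul_mul_iff {σ u v : Equiv.Perm (Fin n)} (hu : LeftLE σ (u * σ))
    (hv : LeftLE σ (v * σ)) : LeftLE (u * σ) (v * σ) ↔ LeftLE u v := by
  rw [leftLE_iff, leftLE_iff]
  constructor
  · intro h a b hab hlt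
    rcases lt_or_gt_of_ne (fun e => hab.ne (σ⁻¹.injective e) : σ⁻¹ a ≠ σ⁻¹ b) with h1 | h1
    · simpa using h _ _ h1 (by simpa using hlt)
    · exact absurd (leftLE_mul_iff.1 hu a b ⟨hab, h1⟩) hlt.not_gt
  · intro h i j hij hlt
    rcases lt_or_gt_of_ne (fun e => hij.ne (σ.injective e) : σ i ≠ σ j) with h1 | h1
    · exact h _ _ h1 hlt
    · exact leftLE_iff.1 hv i j hij h1

theorem mul_mem_leftInterval_iff {σ ξ u : Equiv.Perm (Fin n)} (h : LeftLE σ (ξ * σ)) :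
    u * σ ∈ leftInterval σ (ξ * σ) ↔ LeftLE u ξ := by
  constructor
  · exact fun hu => (leftLE_mul_mul_iff hu.1 h).1 hu.2
  · intro hu
    have h1 : LeftLE σ (u * σ) := leftLE_mul_iff.2 fun a b hab => by
      by_contra hc
      have hlt : u b < u a := lt_of_le_of_ne (not_lt.1 hc) fun e => hab.1.ne' (u.injective e)
      exact absurd (leftLE_mul_iff.1 h a b hab) (leftLE_iff.1 hu a b hab.1 hlt).not_gt
    exact ⟨h1, (leftLE_mul_mul_iff h1 h).2 hu⟩

/-! ### Descent-preserving isomorphisms are right translations -/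

/-- Going up a cover labelled `j` in the left weak order, the only new descent is `j`. -/
theorem eq_of_mem_leftDescents_mul {δ : Equiv.Perm (Fin n)} {i j : Fin (n - 1)}
    (hj : j ∉ leftDescents δ) (hi : i ∉ leftDescents δ)
    (hij : i ∈ leftDescents (simpleTransp j * δ)) : i = j := by
  rw [mem_leftDescents] at hi hij hj
  rw [mul_inv_rev, simpleTransp_inv, Equiv.Perm.mul_apply, Equiv.Perm.mul_apply, simpleTransp,
    Equiv.swap_apply_def, Equiv.swap_apply_def] at hij
  rw [not_lt] at hi hj
  by_contra hne
  have hne' : i.val ≠ j.val := fun e => hne (Fin.ext e)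
  simp only [Fin.mk.injEq, add_left_inj, hne', if_false] at hij
  split_ifs at hij with h1 h2 h2
  · omega
  · have e : (⟨i.val + 1, by omega⟩ : Fin n) = ⟨j.val, by omega⟩ := Fin.ext h1
    rw [e] at hi
    exact absurd (hij.trans_le (hi.trans hj)) (lt_irrefl _)
  · have e : (⟨i.val, by omega⟩ : Fin n) = ⟨j.val + 1, by omega⟩ := Fin.ext h2
    rw [e] at hi
    exact absurd (hij.trans_le (hj.trans hi)) (lt_irrefl _)
  · exact absurd (hij.trans_le hi) (lt_irrefl _)

theorem left_mem_leftInterval {σ ρ : Equiv.Perm (Fin n)} (h : LeftLE σ ρ) :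
    σ ∈ leftInterval σ ρ := ⟨.refl, h⟩

theorem right_mem_leftInterval {σ ρ : Equiv.Perm (Fin n)} (h : LeftLE σ ρ) :
    ρ ∈ leftInterval σ ρ := ⟨h, .refl⟩

/-- An isomorphism of left weak order intervals maps covers to covers. -/
theorem leftCovers_map {σ ρ σ' ρ' : Equiv.Perm (Fin n)}
    (f : leftInterval σ ρ ≃ leftInterval σ' ρ')
    (hf : ∀ γ γ' : leftInterval σ ρ, LeftLE (γ : Equiv.Perm (Fin n)) γ' ↔
      LeftLE (f γ : Equiv.Perm (Fin n)) (f γ'))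
    (γ γ' : leftInterval σ ρ) (h : LeftCovers (γ : Equiv.Perm (Fin n)) γ') :
    LeftCovers (f γ : Equiv.Perm (Fin n)) (f γ') := by
  have hcount := h.inversionCount_eq
  rcases ReflTransGen.cases_head ((hf γ γ').1 (.single h)) with heq | ⟨c, hc, hc'⟩
  · rw [f.injective (Subtype.ext heq)] at hcount
    omega
  · have hcmem : c ∈ leftInterval σ' ρ' :=
      ⟨(f γ).2.1.trans (.single hc), ReflTransGen.trans hc' (f γ').2.2⟩
    -- The preimage of `c` lies between `γ` and `γ'`, whose inversion counts differ by one, and it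
    -- is not `γ`; so it is `γ'`.
    obtain ⟨d, hd⟩ := f.surjective ⟨c, hcmem⟩
    have hdc : (f d : Equiv.Perm (Fin n)) = c := congrArg Subtype.val hd
    have h1 := ((hf γ d).2 (by rw [hdc]; exact .single hc)).eq_or_lt
    have h2 := ((hf d γ').2 (by rw [hdc]; exact hc')).eq_or_lt
    have hdγ : d ≠ γ := by
      rintro rfl
      have := hc.inversionCount_eq
      rw [hdc] at this
      omega
    have hdγ' : d = γ' := Subtype.ext <| h2.resolve_right fun h2 => by
      have := h1.resolve_left fun e => hdγ (Subtype.ext e.symm)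
      omega
    rw [← hdγ', hdc]
    exact hc

/-- A descent-preserving isomorphism of left weak order intervals is a right translation. -/
theorem descEquiv_eq_mul {σ ρ σ' ρ' : Equiv.Perm (Fin n)}
    (h' : LeftLE σ' ρ') (f : leftInterval σ ρ ≃ leftInterval σ' ρ')
    (hf : ∀ γ γ' : leftInterval σ ρ, LeftLE (γ : Equiv.Perm (Fin n)) γ' ↔
      LeftLE (f γ : Equiv.Perm (Fin n)) (f γ'))
    (hd : ∀ γ : leftInterval σ ρ,
      leftDescents (γ : Equiv.Perm (Fin n)) = leftDescents (f γ : Equiv.Perm (Fin n)))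
    (γ : Equiv.Perm (Fin n)) (hγ : γ ∈ leftInterval σ ρ) :
    (f ⟨γ, hγ⟩ : Equiv.Perm (Fin n)) = γ * σ⁻¹ * σ' := by
  have hγ' := hγ.1
  induction hγ' with
  | refl =>
    obtain ⟨d, hd⟩ := f.surjective ⟨σ', left_mem_leftInterval h'⟩
    have h1 : LeftLE (f ⟨σ, hγ⟩ : Equiv.Perm (Fin n)) σ' := by
      simpa [hd] using (hf ⟨σ, hγ⟩ d).1 d.2.1
    simpa using h1.antisymm (f ⟨σ, hγ⟩).2.1
  | @tail β γ hβ hcov ih =>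
    have hβmem : β ∈ leftInterval σ ρ := ⟨hβ, .head hcov hγ.2⟩
    have hmap := leftCovers_map f hf ⟨β, hβmem⟩ ⟨γ, hγ⟩ hcov
    have hdβ := hd ⟨β, hβmem⟩
    have hdγ := hd ⟨γ, hγ⟩
    obtain ⟨i, hi, rfl⟩ := hcov
    obtain ⟨j, hj, hfj⟩ := hmap
    rw [hfj] at hdγ ⊢
    rw [← hdβ] at hj
    -- The label `j` of the image cover is a descent of its top but not of its bottom, hence
    -- likewise for the original cover, whose only new descent is `i`.
    have hmem : j ∈ leftDescents (simpleTransp i * β) := by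
      change leftDescents (simpleTransp i * β) = _ at hdγ
      rw [hdγ, mem_leftDescents]
      rw [hdβ, mem_leftDescents, not_lt] at hj
      rw [mul_inv_rev, simpleTransp_inv, Equiv.Perm.mul_apply, Equiv.Perm.mul_apply, simpleTransp,
        Equiv.swap_apply_left, Equiv.swap_apply_right]
      exact lt_of_le_of_ne hj fun e => by simpa using Equiv.injective _ e
    rw [eq_of_mem_leftDescents_mul hi hj hmem, ih hβmem]
    simp only [mul_assoc]

theorem descEquiv_leftInterval_iff {σ ξ σ' ρ' : Equiv.Perm (Fin n)} (h : LeftLE σ (ξ * σ))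
    (h' : LeftLE σ' ρ') :
    DescEquiv (leftInterval σ (ξ * σ)) (leftInterval σ' ρ') ↔
      ρ' = ξ * σ' ∧ ∀ u, LeftLE u ξ → leftDescents (u * σ) = leftDescents (u * σ') := by
  constructor
  · rintro ⟨f, hf, hd⟩
    have key := descEquiv_eq_mul h' f hf hd
    constructor
    · obtain ⟨d, hd⟩ := f.surjective ⟨ρ', right_mem_leftInterval h'⟩
      have hle : LeftLE ρ' (f ⟨ξ * σ, right_mem_leftInterval h⟩ : Equiv.Perm (Fin n)) := by
        simpa [hd] using (hf d ⟨ξ * σ, right_mem_leftInterval h⟩).1 d.2.2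
      rw [hle.antisymm (f _).2.2, key]
      simp
    · intro u hu
      rw [hd ⟨u * σ, (mul_mem_leftInterval_iff h).2 hu⟩, key]
      simp
  · rintro ⟨rfl, hdes⟩
    have mem : ∀ {α β : Equiv.Perm (Fin n)}, LeftLE α (ξ * α) → LeftLE β (ξ * β) →
        ∀ γ : leftInterval α (ξ * α), (γ : Equiv.Perm (Fin n)) * α⁻¹ * β ∈
          leftInterval β (ξ * β) := fun hα hβ γ =>
      (mul_mem_leftInterval_iff hβ).2 ((mul_mem_leftInterval_iff hα).1 (by simp))
    refine ⟨⟨fun γ => ⟨_, mem h h' γ⟩, fun γ => ⟨_, mem h' h γ⟩, fun γ => ?_, fun γ => ?_⟩,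
      fun γ γ' => ?_, fun γ => ?_⟩
    · simp
    · simp
    · have h1 := leftLE_mul_mul_iff (σ := σ) (u := γ * σ⁻¹) (v := γ' * σ⁻¹)
        (by simpa using γ.2.1) (by simpa using γ'.2.1)
      have h2 := leftLE_mul_mul_iff (mem h h' γ).1 (mem h h' γ').1
      simpa using h1.trans h2.symm
    · have := hdes (γ * σ⁻¹) ((mul_mem_leftInterval_iff h).1 (by simp))
      simpa using this

/-! ### Intervals cut out by cotransitive constraints -/

/-- Prescribing inversions and noninversions by cotransitive relations cuts out an interval of the
right weak order. -/
theorem exists_rightInterval_eq {A B : Fin n → Fin n → Prop}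
    (hA : ∀ {a b c}, a < b → b < c → A a c → A a b ∨ A b c)
    (hB : ∀ {a b c}, a < b → b < c → B a c → B a b ∨ B b c) {τ : Equiv.Perm (Fin n)}
    (hτA : ∀ a b, A a b → Inversion τ a b) (hτB : ∀ a b, B a b → ¬ Inversion τ a b) :
    ∃ σ₀ σ₁, RightLE σ₀ σ₁ ∧
      {σ : Equiv.Perm (Fin n) | (∀ a b, A a b → Inversion σ a b) ∧
        ∀ a b, B a b → ¬ Inversion σ a b} = rightInterval σ₀ σ₁ := by
  set M := {σ : Equiv.Perm (Fin n) | (∀ a b, A a b → Inversion σ a b) ∧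
    ∀ a b, B a b → ¬ Inversion σ a b}
  have hτ : τ ∈ M := ⟨hτA, hτB⟩
  -- The maximum has as inversions the transitive closure of all inversions in `M`; the minimum has
  -- as noninversions the transitive closure of all noninversions. Cotransitivity of `B` and `A`
  -- keeps these closures disjoint from `B` and `A`, so both extremes lie in `M`.
  have hmax := biclosed_transGen_iUnion fun σ : M => biclosed_inversion σ.1
  have hmin' := biclosed_transGen_iUnion fun σ : M => (biclosed_inversion σ.1).compl
  have hmin := hmin'.compl
  obtain ⟨σ₁, -, h₁⟩ := exists_reflTransGen_rightStep hmax 1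
    fun a b h => (not_inversion_one a b h).elim
  obtain ⟨σ₀, -, h₀⟩ := exists_reflTransGen_rightStep hmin 1
    fun a b h => (not_inversion_one a b h).elim
  have hle₁ : ∀ σ ∈ M, RightLE σ σ₁ := fun σ hσ => rightLE_iff.2 fun a b h =>
    (h₁ a b).2 (.single ⟨⟨σ, hσ⟩, h⟩)
  have hle₀ : ∀ σ ∈ M, RightLE σ₀ σ := fun σ hσ => rightLE_iff.2 fun a b h => by
    obtain ⟨hab, hn⟩ := (h₀ a b).1 h
    by_contra hc
    exact hn (.single ⟨⟨σ, hσ⟩, hab, hc⟩)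
  have hB₁ : ∀ a b, B a b → ¬ Inversion σ₁ a b := fun a b hab h =>
    (not_of_transGen (fun ⟨_, h⟩ => h.1) hB (fun ⟨σ, h⟩ hb => σ.2.2 _ _ hb h)
      ((h₁ a b).1 h)).2 hab
  have hA₀ : ∀ a b, A a b → Inversion σ₀ a b := fun a b hab =>
    (h₀ a b).2 ⟨(hτA a b hab).1, fun h =>
      (not_of_transGen (fun ⟨_, h⟩ => h.1) hA (fun ⟨σ, h⟩ ha => h.2 (σ.2.1 _ _ ha)) h).2 hab⟩
  refine ⟨σ₀, σ₁, (hle₀ τ hτ).trans (hle₁ τ hτ), Set.Subset.antisymm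
    (fun σ hσ => ⟨hle₀ σ hσ, hle₁ σ hσ⟩) fun σ hσ => ⟨fun a b h => ?_, fun a b h h' => ?_⟩⟩
  · exact rightLE_iff.1 hσ.1 a b (hA₀ a b h)
  · exact hB₁ a b h (rightLE_iff.1 hσ.2 a b h')

/-! ### Forced inversions and noninversions -/

/-- Inversions common to all `τ` such that the intervals `[σ, ξ σ]_L` and `[τ, ξ τ]_L` are
descent-equivalent. -/
def ForcedInversion (ξ σ : Equiv.Perm (Fin n)) (x y : Fin n) : Prop :=
  x < y ∧ ∃ u, LeftLE u ξ ∧ ∃ a c, (u c).val = (u a).val + 1 ∧ Inversion σ a c ∧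
    a ≤ x ∧ y ≤ c ∧ u x ≤ u a ∧ u c ≤ u y

/-- Noninversions common to all `τ` such that the intervals `[σ, ξ σ]_L` and `[τ, ξ τ]_L` are
descent-equivalent. -/
def ForcedNoninversion (ξ σ : Equiv.Perm (Fin n)) (a c : Fin n) : Prop :=
  a < c ∧ (ξ c < ξ a ∨
    ∃ u, LeftLE u ξ ∧ (u c).val = (u a).val + 1 ∧ ¬ Inversion σ a c)

/-- No value lies strictly between `u a` and `u c`, so `u b ≤ u a` or `u c ≤ u b`. Allowing `x, y`
besides the adjacent pair `a, c` is what makes this closure hold. -/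
theorem forcedInversion_cotrans {ξ σ : Equiv.Perm (Fin n)} {x b y : Fin n} (hxb : x < b)
    (hby : b < y) (h : ForcedInversion ξ σ x y) :
    ForcedInversion ξ σ x b ∨ ForcedInversion ξ σ b y := by
  obtain ⟨-, u, hu, a, c, hac, hi, hax, hyc, hxa, hcy⟩ := h
  rcases le_or_gt (u b) (u a) with hb | hb
  · exact Or.inr ⟨hby, u, hu, a, c, hac, hi, hax.trans hxb.le, hyc, hb, hcy⟩
  · refine Or.inl ⟨hxb, u, hu, a, c, hac, hi, hax, hby.le.trans hyc, hxa, ?_⟩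
    rw [Fin.lt_def] at hb
    rw [Fin.le_def]
    omega

/-- In the adjacent case `u b` falls outside the range from `u a` to `u c`, so `u`, and therefore
`ξ`, reverses one of the two shorter pairs. -/
theorem forcedNoninversion_cotrans {ξ σ : Equiv.Perm (Fin n)} {a b c : Fin n} (hab : a < b)
    (hbc : b < c) (h : ForcedNoninversion ξ σ a c) :
    ForcedNoninversion ξ σ a b ∨ ForcedNoninversion ξ σ b c := by
  obtain ⟨-, h | ⟨u, hu, hac, hi⟩⟩ := h
  · rcases lt_or_ge (ξ b) (ξ a) with h' | h'
    · exact Or.inl ⟨hab, Or.inl h'⟩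
    · exact Or.inr ⟨hbc, Or.inl (h.trans_le h')⟩
  · rcases lt_trichotomy (u b) (u a) with h' | h' | h'
    · exact Or.inl ⟨hab, Or.inl (leftLE_iff.1 hu a b hab h')⟩
    · exact absurd (u.injective h') hab.ne'
    · refine Or.inr ⟨hbc, Or.inl (leftLE_iff.1 hu b c hbc ?_)⟩
      have h1 : (u b).val ≠ (u c).val := fun e => hbc.ne (u.injective (Fin.ext e))
      rw [Fin.lt_def] at h' ⊢
      omega

theorem mem_leftDescents_mul_iff {σ u : Equiv.Perm (Fin n)} {i : Fin (n - 1)} :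
    i ∈ leftDescents (u * σ) ↔
      σ⁻¹ (u⁻¹ ⟨i.val + 1, by omega⟩) < σ⁻¹ (u⁻¹ ⟨i.val, by omega⟩) := by
  rw [mem_leftDescents, mul_inv_rev]
  rfl

theorem leftDescents_mul_eq_iff {σ τ u : Equiv.Perm (Fin n)} :
    leftDescents (u * σ) = leftDescents (u * τ) ↔
      ∀ a c, (u c).val = (u a).val + 1 → (σ⁻¹ c < σ⁻¹ a ↔ τ⁻¹ c < τ⁻¹ a) := by
  simp only [Set.ext_iff, mem_leftDescents_mul_iff]
  constructor
  · intro h a c hac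
    have h1 := h ⟨(u a).val, by omega⟩
    have h2 : (⟨(u a).val + 1, by omega⟩ : Fin n) = u c := Fin.ext hac.symm
    simpa [h2] using h1
  · intro h i
    exact h _ _ (by simp)

theorem leftLE_and_leftDescents_eq_iff {ξ σ τ : Equiv.Perm (Fin n)} (hσ : LeftLE σ (ξ * σ)) :
    (LeftLE τ (ξ * τ) ∧ ∀ u, LeftLE u ξ → leftDescents (u * σ) = leftDescents (u * τ)) ↔
      (∀ a b, ForcedInversion ξ σ a b → Inversion τ a b) ∧
        ∀ a b, ForcedNoninversion ξ σ a b → ¬ Inversion τ a b := by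
  simp only [leftDescents_mul_eq_iff]
  rw [leftLE_mul_iff] at *
  constructor
  · rintro ⟨hτ, hd⟩
    constructor
    · rintro x y ⟨hxy, u, hu, a, c, hac, hi, hax, hyc, hxa, hcy⟩
      refine ⟨hxy, ?_⟩
      -- A pair reversed by `u` is reversed by `ξ`, so it is not an inversion of `τ`. In the word of
      -- `τ` this puts `y` weakly before `c`, `c` before `a`, and `a` weakly before `x`.
      have before : ∀ {a b}, a ≤ b → u b ≤ u a → τ⁻¹ a ≤ τ⁻¹ b := fun {a b} hab hba => by
        rcases hab.eq_or_lt with rfl | hab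
        · rfl
        · refine not_lt.1 fun h => (hτ a b ⟨hab, h⟩).not_gt (leftLE_iff.1 hu a b hab ?_)
          exact lt_of_le_of_ne hba fun e => hab.ne' (u.injective e)
      exact (before hyc hcy).trans_lt (((hd u hu a c hac).1 hi.2).trans_le (before hax hxa))
    · rintro a c ⟨hlt, h | ⟨u, hu, hac, hi⟩⟩ hinv
      · exact (hτ a c hinv).not_gt h
      · exact hi ⟨hlt, (hd u hu a c hac).2 hinv.2⟩
  · rintro ⟨hA, hB⟩
    have hτ : ∀ a b, Inversion τ a b → ξ a < ξ b := fun a b h => by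
      by_contra hc
      refine hB a b ⟨h.1, Or.inl (lt_of_le_of_ne (not_lt.1 hc) fun e => ?_)⟩ h
      exact h.1.ne' (ξ.injective e)
    refine ⟨hτ, fun u hu a c hac => ?_⟩
    have hne : a ≠ c := by rintro rfl; omega
    have huac : u a < u c := by rw [Fin.lt_def]; omega
    rcases lt_or_gt_of_ne hne with h | h
    · constructor
      · exact fun h' => (hA a c ⟨h, u, hu, a, c, hac, ⟨h, h'⟩, le_rfl, le_rfl, le_rfl, le_rfl⟩).2
      · intro h'
        by_contra hc
        exact hB a c ⟨h, Or.inr ⟨u, hu, hac, fun hi => hc hi.2⟩⟩ ⟨h, h'⟩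
    -- Here `u` reverses the pair `c < a`, so neither `σ` nor `τ` can have it as an inversion.
    · have hξ := leftLE_iff.1 hu c a h huac
      have aux : ∀ π : Equiv.Perm (Fin n), (∀ a b, Inversion π a b → ξ a < ξ b) →
          π⁻¹ c < π⁻¹ a := fun π hπ => by
        refine lt_of_le_of_ne (not_lt.1 fun h' => (hπ c a ⟨h, h'⟩).not_gt hξ) fun e => ?_
        exact hne (π⁻¹.injective e).symm
      exact iff_of_true (aux σ hσ) (aux τ hτ)

/-! ### From minima to maxima -/

theorem rightLE_mul_mul_iff {ξ σ τ : Equiv.Perm (Fin n)} (hσ : LeftLE σ (ξ * σ)) :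
    RightLE (ξ * σ) (ξ * τ) ↔ RightLE σ τ ∧ LeftLE τ (ξ * τ) := by
  rw [leftLE_mul_iff] at *
  rw [rightLE_iff, rightLE_iff]
  simp only [Inversion, mul_inv_rev, Equiv.Perm.mul_apply] at *
  constructor
  · intro h
    have h' : ∀ a b, ξ a < ξ b → σ⁻¹ b < σ⁻¹ a → τ⁻¹ b < τ⁻¹ a := fun a b hab hlt => by
      simpa using (h (ξ a) (ξ b) ⟨hab, by simpa using hlt⟩).2
    refine ⟨fun a b hab => ⟨hab.1, h' a b (hσ a b hab) hab.2⟩, fun a b hab => ?_⟩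
    by_contra hc
    -- If `ξ` reversed an inversion of `τ`, then `σ` would have that pair in order, making it an
    -- inversion of `ξ * σ` but not of `ξ * τ`.
    have hlt : ξ b < ξ a := lt_of_le_of_ne (not_lt.1 hc) fun e => hab.1.ne' (ξ.injective e)
    have hs : σ⁻¹ a < σ⁻¹ b := by
      refine lt_of_le_of_ne (not_lt.1 fun hs => hc (hσ a b ⟨hab.1, hs⟩)) fun e => ?_
      exact hab.1.ne (σ⁻¹.injective e)
    exact (h' b a hlt hs).not_gt hab.2
  · rintro ⟨h, hτ⟩ c d ⟨hcd, hlt⟩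
    refine ⟨hcd, ?_⟩
    obtain ⟨a, rfl⟩ := ξ.surjective c
    obtain ⟨b, rfl⟩ := ξ.surjective d
    simp only [Equiv.Perm.coe_inv, Equiv.symm_apply_apply] at hlt ⊢
    have hne : a ≠ b := by rintro rfl; exact lt_irrefl _ hcd
    rcases lt_or_gt_of_ne hne with hab | hab
    · exact (h a b ⟨hab, hlt⟩).2
    · refine lt_of_le_of_ne (not_lt.1 fun h' => (hτ b a ⟨hab, h'⟩).not_gt hcd) fun e => ?_
      exact hne (τ⁻¹.injective e).symm

end WeakBruhat

theorem theorem4p5 (n : ℕ) (C : Set (Set (Equiv.Perm (Fin n))))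
    (hC : WeakBruhat.IsDescClass C) :
    ∃ ξ σ₀ σ₁ ρ₀ ρ₁ : Equiv.Perm (Fin n),
      -- the common value of `ρ σ⁻¹` over all intervals `[σ, ρ]_L` in `C`
      (∀ σ ρ : Equiv.Perm (Fin n), WeakBruhat.LeftLE σ ρ →
        WeakBruhat.leftInterval σ ρ ∈ C → ρ * σ⁻¹ = ξ) ∧
      -- the minima form a right weak Bruhat interval
      WeakBruhat.RightLE σ₀ σ₁ ∧
      WeakBruhat.minima C = WeakBruhat.rightInterval σ₀ σ₁ ∧
      -- the maxima form a right weak Bruhat interval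
      WeakBruhat.RightLE ρ₀ ρ₁ ∧
      WeakBruhat.maxima C = WeakBruhat.rightInterval ρ₀ ρ₁ ∧
      -- the resulting description of `C`
      C = {I | ∃ γ ∈ WeakBruhat.rightInterval σ₀ σ₁,
        I = WeakBruhat.leftInterval γ (ξ * γ)} := by
  obtain ⟨_, ⟨σ, ρ, hσρ, rfl⟩, rfl⟩ := hC
  obtain ⟨ξ, rfl⟩ : ∃ ξ, ρ = ξ * σ := ⟨ρ * σ⁻¹, by simp⟩
  set C : Set (Set (Equiv.Perm (Fin n))) :=
    {J | J ∈ WeakBruhat.leftIntervals n ∧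
      WeakBruhat.DescEquiv (WeakBruhat.leftInterval σ (ξ * σ)) J}
  have memC : ∀ {τ π}, WeakBruhat.LeftLE τ π → (WeakBruhat.leftInterval τ π ∈ C ↔
      π = ξ * τ ∧ ∀ u, WeakBruhat.LeftLE u ξ →
        WeakBruhat.leftDescents (u * σ) = WeakBruhat.leftDescents (u * τ)) := fun {τ π} h => by
    rw [← WeakBruhat.descEquiv_leftInterval_iff hσρ h]
    exact ⟨fun h' => h'.2, fun h' => ⟨⟨τ, π, h, rfl⟩, h'⟩⟩
  have mem_min : ∀ τ, τ ∈ WeakBruhat.minima C ↔ WeakBruhat.LeftLE τ (ξ * τ) ∧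
      WeakBruhat.leftInterval τ (ξ * τ) ∈ C := fun τ => by
    constructor
    · rintro ⟨π, h, hC⟩
      obtain rfl := ((memC h).1 hC).1
      exact ⟨h, hC⟩
    · exact fun h => ⟨_, h⟩
  have mem_max : ∀ τ, ξ * τ ∈ WeakBruhat.maxima C ↔ τ ∈ WeakBruhat.minima C := fun τ => by
    rw [mem_min]
    constructor
    · rintro ⟨τ', h, hC⟩
      obtain rfl := mul_left_cancel ((memC h).1 hC).1
      exact ⟨h, hC⟩
    · exact fun h => ⟨_, h⟩
  have min_eq : WeakBruhat.minima C = {τ | (∀ a b, WeakBruhat.ForcedInversion ξ σ a b →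
      WeakBruhat.Inversion τ a b) ∧ ∀ a b, WeakBruhat.ForcedNoninversion ξ σ a b →
        ¬ WeakBruhat.Inversion τ a b} := by
    ext τ
    refine (mem_min τ).trans (Iff.trans (and_congr_right fun h => ?_)
      (WeakBruhat.leftLE_and_leftDescents_eq_iff hσρ))
    rw [memC h]
    simp
  -- The original minimum `σ` satisfies its own constraints, so the set they cut out is nonempty.
  have hforced := (WeakBruhat.leftLE_and_leftDescents_eq_iff hσρ).1 ⟨hσρ, fun _ _ => rfl⟩
  obtain ⟨σ₀, σ₁, h₀₁, hM⟩ := WeakBruhat.exists_rightInterval_eq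
    WeakBruhat.forcedInversion_cotrans WeakBruhat.forcedNoninversion_cotrans hforced.1 hforced.2
  rw [← min_eq] at hM
  have hσ₀ := ((mem_min σ₀).1 (by rw [hM]; exact ⟨.refl, h₀₁⟩)).1
  have hσ₁ := ((mem_min σ₁).1 (by rw [hM]; exact ⟨h₀₁, .refl⟩)).1
  refine ⟨ξ, σ₀, σ₁, ξ * σ₀, ξ * σ₁, fun τ π h hC => ?_, h₀₁, hM,
    (WeakBruhat.rightLE_mul_mul_iff hσ₀).2 ⟨h₀₁, hσ₁⟩, ?_, ?_⟩
  · rw [((memC h).1 hC).1, mul_inv_cancel_right]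
  · ext π
    obtain ⟨τ, rfl⟩ : ∃ τ, π = ξ * τ := ⟨ξ⁻¹ * π, by simp⟩
    rw [mem_max]
    constructor
    · intro h
      have hτ := ((mem_min τ).1 h).1
      rw [hM] at h
      exact ⟨(WeakBruhat.rightLE_mul_mul_iff hσ₀).2 ⟨h.1, hτ⟩,
        (WeakBruhat.rightLE_mul_mul_iff hτ).2 ⟨h.2, hσ₁⟩⟩
    · rintro ⟨h1, h2⟩
      obtain ⟨h1, hτ⟩ := (WeakBruhat.rightLE_mul_mul_iff hσ₀).1 h1
      rw [hM]
      exact ⟨h1, ((WeakBruhat.rightLE_mul_mul_iff hτ).1 h2).1⟩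
  · rw [← hM]
    ext I
    constructor
    · intro hI
      obtain ⟨τ, π, h, rfl⟩ := hI.1
      obtain rfl := ((memC h).1 hI).1
      exact ⟨τ, (mem_min τ).2 ⟨h, hI⟩, rfl⟩
    · rintro ⟨τ, hτ, rfl⟩
      exact ((mem_min τ).1 hτ).2
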